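/- Let $\mathrm{Li}_2(z)=-\int_0^1 \frac{\mathrm{Log}(1-tz)}{t}\,dt$ for $z\in\mathbb C\setminus[1,\infty)$ ($\mathrm{Log}$ the principal logarithm) be the dilogarithm, i.e. the analytic continuation of $\sum_{n\ge1} z^n/n^2$ from the unit disc. For every real $a>1$, the function $x\mapsto \frac{\mathrm{Li}_2(-x^a)+\mathrm{Li}_2(-x^{-a})}{1+x^a}$ is Lebesgue integrable on $(0,\infty)$, and $$\int_0^\infty \frac{\mathrm{Li}_2(-x^a)+\mathrm{Li}_2(-x^{-a})}{1+x^a}\,dx=\frac{\pi^3}{3a}\cdot\frac{\sin^2(\pi/a)-3}{\sin^3(\pi/a)}.$$ -/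

import Mathlib

/-- The principal branch of the dilogarithm, `Li₂(z) = -∫₀^z Log(1 - u) / u du`, integrated along
the straight segment `u = t z`, `0 ≤ t ≤ 1`. It is the analytic continuation of
`∑_{n ≥ 1} z ^ n / n ^ 2` from the open unit disc to `ℂ` slit along `[1, ∞)`. -/
noncomputable def dilog (z : ℂ) : ℂ :=
  -∫ t in (0 : ℝ)..1, Complex.log (1 - (t : ℂ) * z) / (t : ℂ)

open MeasureTheory Set Filter Topology Asymptotics

/-! For `y > 0` the inversion formula gives `Li₂(-y) + Li₂(-1/y) = -π²/6 - (log y)²/2`, so with `y =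
x ^ a` the numerator is elementary. Substituting `t = x ^ a` turns the integral into `1/a` times the
Mellin transform of `(-π²/6 - (log t)²/2) / (1 + t)` at `s = 1/a`, which lies in the strip `0 < re s
< 1` because `a > 1`. There `1 / (1 + t)` has transform `π / sin (π s)`, and each factor `log t`
amounts to a derivative in `s`. -/

/-! ### Inversion formula for the dilogarithm on the negative axis -/

theorem hasSum_neg_one_pow_div_sq :
    HasSum (fun n : ℕ => (-1 : ℝ) ^ n * (1 / ((n : ℝ) + 1) ^ 2)) (Real.pi ^ 2 / 12) := by
  have hz := hasSum_zeta_two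
  have he : HasSum (fun k : ℕ => (1 : ℝ) / ((2 * k : ℕ) : ℝ) ^ 2) (Real.pi ^ 2 / 24) := by
    convert! hz.mul_left (1 / 4) using 1
    · ext k
      push_cast
      rw [mul_pow, ← one_div_mul_one_div]
      norm_num
    · ring
  have hs : Summable (fun k : ℕ => (1 : ℝ) / ((2 * k + 1 : ℕ) : ℝ) ^ 2) :=
    hz.summable.comp_injective (i := fun k : ℕ => 2 * k + 1) fun i j h => by
      simpa using h
  have ho := hs.hasSum
  have hsum := (he.even_add_odd (f := fun n : ℕ => (1 : ℝ) / (n : ℝ) ^ 2) ho).unique hz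
  have hall : HasSum (fun n : ℕ => (-1 : ℝ) ^ n * (1 / (n : ℝ) ^ 2))
      (Real.pi ^ 2 / 24 + -(∑' k : ℕ, (1 : ℝ) / ((2 * k + 1 : ℕ) : ℝ) ^ 2)) := by
    apply HasSum.even_add_odd
    · simpa [pow_mul] using he
    · simpa [pow_succ, pow_mul] using ho.neg
  -- The dropped term `n = 0` is `1 / 0 = 0`; the index shift flips the sign, hence `h1.neg`.
  have h1 := (hasSum_nat_add_iff' 1).2 hall
  convert! h1.neg using 1
  · ext n
    push_cast
    ring
  · simp at *
    linarith

theorem integrableOn_log_one_add_div {y : ℝ} :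
    IntegrableOn (fun u : ℝ => Real.log (1 + u) / u) (Ioc 0 y) := by
  refine Measure.integrableOn_of_bounded (M := 1) (by simp) ?_ ?_
  · exact (Measurable.div (Real.measurable_log.comp (measurable_const.add measurable_id))
      measurable_id).aestronglyMeasurable
  · refine (ae_restrict_iff' measurableSet_Ioc).2 (ae_of_all _ fun u hu => ?_)
    have hu0 : 0 < u := hu.1
    rw [Real.norm_eq_abs, abs_of_nonneg (div_nonneg (Real.log_nonneg (by linarith)) hu0.le),
      div_le_one hu0]
    have := Real.log_le_sub_one_of_pos (show 0 < 1 + u by linarith)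
    linarith

theorem dilog_neg_ofReal {y : ℝ} (hy : 0 < y) :
    dilog ((-y : ℝ) : ℂ) = ((-∫ u in (0 : ℝ)..y, Real.log (1 + u) / u : ℝ) : ℂ) := by
  have h : ∫ t in (0 : ℝ)..1, Complex.log (1 - (t : ℂ) * ((-y : ℝ) : ℂ)) / (t : ℂ) =
      ((∫ t in (0 : ℝ)..1, y * (Real.log (1 + y * t) / (y * t)) : ℝ) : ℂ) := by
    rw [← intervalIntegral.integral_ofReal]
    refine intervalIntegral.integral_congr fun t ht => ?_
    rw [uIcc_of_le zero_le_one] at ht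
    have e : (1 : ℂ) - (t : ℂ) * ((-y : ℝ) : ℂ) = ((1 + y * t : ℝ) : ℂ) := by
      push_cast; ring
    -- At `t = 0` both sides vanish, since division by zero gives zero.
    have : y * (Real.log (1 + y * t) / (y * t)) = Real.log (1 + y * t) / t := by
      rcases eq_or_ne t 0 with rfl | h0
      · simp
      · field_simp
    simp only [this]
    rw [e, ← Complex.ofReal_log (by nlinarith [ht.1])]
    push_cast; rfl
  rw [dilog, h, intervalIntegral.integral_const_mul,
    intervalIntegral.mul_integral_comp_mul_left (f := fun u => Real.log (1 + u) / u)]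
  simp

/-- The series of `log (1 + u) / u` is integrated term by term; the integrals of the norms sum to
`ζ(2)`. -/
theorem integral_log_one_add_div_zero_one :
    ∫ u in (0 : ℝ)..1, Real.log (1 + u) / u = Real.pi ^ 2 / 12 := by
  have hint : ∀ n : ℕ, ∫ u in Ioc (0 : ℝ) 1, u ^ n = 1 / ((n : ℝ) + 1) := fun n => by
    rw [← intervalIntegral.integral_of_le zero_le_one]
    simp
  let F : ℕ → ℝ → ℝ := fun n u => (-1) ^ n * (1 / ((n : ℝ) + 1)) * u ^ n
  have hF : ∀ n, Integrable (F n) (volume.restrict (Ioc 0 1)) := fun n =>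
    ((continuous_const.mul (continuous_pow n)).integrableOn_Icc.mono_set Ioc_subset_Icc_self)
  have hFint : ∀ n, ∫ u in Ioc (0 : ℝ) 1, F n u = (-1 : ℝ) ^ n * (1 / ((n : ℝ) + 1) ^ 2) := by
    intro n
    simp only [F]
    rw [integral_const_mul, hint]
    field_simp
  have hFnorm : ∀ n, ∫ u in Ioc (0 : ℝ) 1, ‖F n u‖ = 1 / ((n : ℝ) + 1) ^ 2 := by
    intro n
    have : ∫ u in Ioc (0 : ℝ) 1, ‖F n u‖ = ∫ u in Ioc (0 : ℝ) 1, (1 / ((n : ℝ) + 1)) * u ^ n := by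
      refine setIntegral_congr_fun measurableSet_Ioc fun u hu => ?_
      have h1 : (0 : ℝ) ≤ (n : ℝ) + 1 := by positivity
      simp [F, abs_of_nonneg hu.1.le, abs_of_nonneg h1]
    rw [this, integral_const_mul, hint]
    field_simp
  have hs : Summable fun n => ∫ u in Ioc (0 : ℝ) 1, ‖F n u‖ := by
    simp only [hFnorm]
    simpa using (hasSum_neg_one_pow_div_sq.summable.norm)
  have h := hasSum_integral_of_summable_integral_norm hF hs
  simp only [hFint] at h
  -- The endpoint `u = 1` is discarded because the logarithm series is used only for `|u| < 1`.
  rw [intervalIntegral.integral_of_le zero_le_one, ← h.unique hasSum_neg_one_pow_div_sq,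
    integral_Ioc_eq_integral_Ioo, integral_Ioc_eq_integral_Ioo]
  refine setIntegral_congr_fun measurableSet_Ioo fun u hu => ?_
  have hu0 : u ≠ 0 := hu.1.ne'
  have hl := Real.hasSum_pow_div_log_of_abs_lt_one (x := -u)
    (by rw [abs_neg, abs_of_pos hu.1]; exact hu.2)
  have := (hl.mul_left (-u⁻¹)).tsum_eq
  simp only [sub_neg_eq_add] at this
  rw [show Real.log (1 + u) / u = -u⁻¹ * -Real.log (1 + u) by ring, ← this]
  refine tsum_congr fun n => ?_
  simp only [F]
  rw [neg_pow u, pow_succ, pow_succ]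
  field_simp

theorem hasDerivAt_integral_log_one_add_div {y : ℝ} (hy : 0 < y) :
    HasDerivAt (fun y : ℝ => ∫ u in (0 : ℝ)..y, Real.log (1 + u) / u) (Real.log (1 + y) / y) y := by
  refine intervalIntegral.integral_hasDerivAt_right ?_ ?_ ?_
  · exact (intervalIntegrable_iff_integrableOn_Ioc_of_le hy.le).2 integrableOn_log_one_add_div
  · exact (Measurable.stronglyMeasurable (Measurable.div (Real.measurable_log.comp
      (measurable_const.add measurable_id)) measurable_id)).stronglyMeasurableAtFilter
  · have : 1 + y ≠ 0 := by positivity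
    fun_prop (disch := first | assumption | exact hy.ne')

/-- Both sides have the same derivative on `(0, ∞)`, and `y = 1` fixes the constant as `2 · π²/12`.
-/
theorem integral_log_one_add_div_add_inv {y : ℝ} (hy : 0 < y) :
    (∫ u in (0 : ℝ)..y, Real.log (1 + u) / u) + ∫ u in (0 : ℝ)..y⁻¹, Real.log (1 + u) / u =
      Real.pi ^ 2 / 6 + Real.log y ^ 2 / 2 := by
  let D : ℝ → ℝ := fun y => (∫ u in (0 : ℝ)..y, Real.log (1 + u) / u) +
    (∫ u in (0 : ℝ)..y⁻¹, Real.log (1 + u) / u) - Real.log y ^ 2 / 2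
  have hD : ∀ y ∈ Ioi (0 : ℝ), HasDerivAt D 0 y := by
    intro y (hy : 0 < y)
    have h1 := hasDerivAt_integral_log_one_add_div hy
    have h2 := (hasDerivAt_integral_log_one_add_div (inv_pos.2 hy)).comp y (hasDerivAt_inv hy.ne')
    have h3 := ((Real.hasDerivAt_log hy.ne').pow 2).div_const 2
    convert! (h1.add h2).sub h3 using 1
    have : (1 : ℝ) + y⁻¹ = (1 + y) / y := by field_simp; ring
    rw [this, Real.log_div (by positivity) hy.ne']
    field_simp
    ring
  have hc : D y = D 1 := by
    refine isOpen_Ioi.is_const_of_deriv_eq_zero isPreconnected_Ioi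
      (fun y hy => (hD y hy).differentiableAt.differentiableWithinAt)
      (fun y hy => (hD y hy).deriv) hy (mem_Ioi.2 one_pos)
  simp only [D, inv_one, integral_log_one_add_div_zero_one, Real.log_one] at hc
  linarith

theorem dilog_neg_add_dilog_neg_inv {y : ℝ} (hy : 0 < y) :
    dilog ((-y : ℝ) : ℂ) + dilog ((-y⁻¹ : ℝ) : ℂ) =
      ((-(Real.pi ^ 2 / 6) - Real.log y ^ 2 / 2 : ℝ) : ℂ) := by
  rw [dilog_neg_ofReal hy, dilog_neg_ofReal (inv_pos.2 hy), ← Complex.ofReal_add]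
  have := integral_log_one_add_div_add_inv hy
  congr 1
  linarith

/-! ### Mellin transforms of `1 / (1 + t)` with powers of `log t` -/

theorem image_div_one_add_Ioi : (fun x : ℝ => x / (1 + x)) '' Ioi 0 = Ioo 0 1 := by
  ext t
  constructor
  · rintro ⟨x, hx : 0 < x, rfl⟩
    exact ⟨by positivity, (div_lt_one (by positivity)).2 (by linarith)⟩
  · rintro ⟨h0, h1⟩
    have : 0 < 1 - t := by linarith
    refine ⟨t / (1 - t), div_pos h0 this, ?_⟩
    have : 1 + t / (1 - t) = 1 / (1 - t) := by field_simp; ring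
    simp only [this]
    field_simp

/-- The substitution `u = x / (1 + x)` carries the beta integral `B(s, 1 - s)` to this transform;
Euler's reflection formula evaluates it. -/
theorem mellin_one_add_inv {s : ℂ} (h0 : 0 < s.re) (h1 : s.re < 1) :
    mellin (fun t : ℝ => ((1 : ℂ) + t)⁻¹) s = Real.pi / Complex.sin (Real.pi * s) := by
  have hB := Complex.Gamma_mul_Gamma_eq_betaIntegral (s := s) (t := 1 - s) h0 (by simpa using h1)
  rw [Complex.Gamma_mul_Gamma_one_sub, add_sub_cancel, Complex.Gamma_one, one_mul] at hB
  rw [hB, Complex.betaIntegral, intervalIntegral.integral_of_le zero_le_one,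
    integral_Ioc_eq_integral_Ioo, ← image_div_one_add_Ioi,
    integral_image_eq_integral_abs_deriv_smul (f' := fun x => 1 / (1 + x) ^ 2) measurableSet_Ioi,
    mellin]
  · refine setIntegral_congr_fun measurableSet_Ioi fun x (hx : 0 < x) => ?_
    have hx1 : 0 < 1 + x := by linarith
    have hxc : ((1 : ℂ) + x) ≠ 0 := by exact_mod_cast hx1.ne'
    have e1 : (((x / (1 + x) : ℝ) : ℂ)) ^ (s - 1) =
        (x : ℂ) ^ (s - 1) / ((1 + x : ℝ) : ℂ) ^ (s - 1) := by
      rw [Complex.ofReal_div, Complex.div_cpow_ofReal_nonneg hx.le hx1.le]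
    have e2 : (1 - ((x / (1 + x) : ℝ) : ℂ)) = (((1 + x)⁻¹ : ℝ) : ℂ) := by
      push_cast; field_simp; ring
    have e3 : ((((1 + x)⁻¹ : ℝ)) : ℂ) ^ (1 - s - 1) = ((1 + x : ℝ) : ℂ) ^ s := by
      rw [Complex.ofReal_inv, ← Complex.ofReal_inv, Complex.ofReal_inv,
        Complex.inv_cpow _ _ (by rw [Complex.arg_ofReal_of_nonneg hx1.le]; exact Real.pi_pos.ne),
        ← Complex.cpow_neg]
      congr 1; ring
    have e4 : ((1 + x : ℝ) : ℂ) ^ s = ((1 + x : ℝ) : ℂ) ^ (s - 1) * ((1 + x : ℝ) : ℂ) := by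
      rw [Complex.cpow_sub _ _ (by exact_mod_cast hx1.ne'), Complex.cpow_one]
      push_cast
      field_simp
    have e5 : ((1 + x : ℝ) : ℂ) ^ (s - 1) ≠ 0 := by
      rw [Complex.cpow_ne_zero_iff]
      exact Or.inl (by exact_mod_cast hx1.ne')
    simp only [smul_eq_mul, Complex.real_smul]
    rw [e1, e2, e3, e4, abs_of_pos (by positivity)]
    field_simp
    push_cast
    field_simp
  · intro x (hx : 0 < x)
    have hx1 : 1 + x ≠ 0 := by positivity
    have := (hasDerivAt_id x).div ((hasDerivAt_id x).const_add 1) hx1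
    convert! this.hasDerivWithinAt using 1
    simp
  · intro x (hx : 0 < x) y (hy : 0 < y) h
    have hx1 : 1 + x ≠ 0 := by positivity
    have hy1 : 1 + y ≠ 0 := by positivity
    simp only at h
    rw [div_eq_div_iff hx1 hy1] at h
    linarith

theorem continuousOn_one_add_inv : ContinuousOn (fun t : ℝ => ((1 : ℂ) + t)⁻¹) (Ioi 0) := by
  refine ContinuousOn.inv₀ (by fun_prop) fun t (ht : 0 < t) => ?_
  exact_mod_cast (by positivity : 1 + t ≠ 0)

theorem isBigO_one_add_inv_atTop :
    (fun t : ℝ => ((1 : ℂ) + t)⁻¹) =O[atTop] (· ^ (-1 : ℝ) : ℝ → ℝ) := by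
  refine IsBigO.of_bound 1 ?_
  filter_upwards [eventually_gt_atTop 0] with t ht
  rw [one_mul, Real.rpow_neg_one, norm_inv, norm_inv]
  have e : (1 : ℂ) + t = ((1 + t : ℝ) : ℂ) := by push_cast; rfl
  rw [e, Complex.norm_real, Real.norm_of_nonneg ht.le, Real.norm_of_nonneg (by positivity)]
  gcongr
  linarith

theorem isBigO_one_add_inv_zero :
    (fun t : ℝ => ((1 : ℂ) + t)⁻¹) =O[𝓝[>] 0] (· ^ (-0 : ℝ) : ℝ → ℝ) := by
  refine IsBigO.of_bound 1 ?_
  filter_upwards [self_mem_nhdsWithin] with t (ht : 0 < t)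
  rw [one_mul, neg_zero, Real.rpow_zero, norm_inv, norm_one]
  have e : (1 : ℂ) + t = ((1 + t : ℝ) : ℂ) := by push_cast; rfl
  rw [e, Complex.norm_real, Real.norm_of_nonneg (by positivity)]
  exact inv_le_one_of_one_le₀ (by linarith)

theorem mellinConvergent_one_add_inv {s : ℂ} (h0 : 0 < s.re) (h1 : s.re < 1) :
    MellinConvergent (fun t : ℝ => ((1 : ℂ) + t)⁻¹) s :=
  mellinConvergent_of_isBigO_rpow (continuousOn_one_add_inv.locallyIntegrableOn measurableSet_Ioi)
    isBigO_one_add_inv_atTop h1 isBigO_one_add_inv_zero h0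

theorem hasDerivAt_mellin_one_add_inv {s : ℂ} (h0 : 0 < s.re) (h1 : s.re < 1) :
    HasDerivAt (mellin fun t : ℝ => ((1 : ℂ) + t)⁻¹)
      (mellin (fun t : ℝ => Real.log t • ((1 : ℂ) + t)⁻¹) s) s :=
  (mellin_hasDerivAt_of_isBigO_rpow
    (continuousOn_one_add_inv.locallyIntegrableOn measurableSet_Ioi)
    isBigO_one_add_inv_atTop h1 isBigO_one_add_inv_zero h0).2

theorem hasDerivAt_mellin_log_smul_one_add_inv {s : ℂ} (h0 : 0 < s.re) (h1 : s.re < 1) :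
    MellinConvergent (fun t : ℝ => Real.log t • Real.log t • ((1 : ℂ) + t)⁻¹) s ∧
    HasDerivAt (mellin fun t : ℝ => Real.log t • ((1 : ℂ) + t)⁻¹)
      (mellin (fun t : ℝ => Real.log t • Real.log t • ((1 : ℂ) + t)⁻¹) s) s := by
  -- A logarithm costs an arbitrarily small power at each end, so the exponents `1` and `0` are
  -- relaxed to `a` and `b` with `0 < b < re s < a < 1`.
  obtain ⟨a, ha, ha'⟩ := exists_between h1
  obtain ⟨b, hb, hb'⟩ := exists_between h0
  refine mellin_hasDerivAt_of_isBigO_rpow (a := a) (b := b) ?_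
    (isBigO_rpow_top_log_smul ha' isBigO_one_add_inv_atTop) ha
    (isBigO_rpow_zero_log_smul hb isBigO_one_add_inv_zero) hb'
  have hlog : ContinuousOn Real.log (Ioi 0) :=
    Real.continuousOn_log.mono fun t (ht : 0 < t) => ht.ne'
  have hc : ContinuousOn (fun t : ℝ => Real.log t • ((1 : ℂ) + t)⁻¹) (Ioi 0) :=
    hlog.smul continuousOn_one_add_inv
  exact hc.locallyIntegrableOn measurableSet_Ioi

theorem sin_pi_mul_ne_zero_of_mem_strip {s : ℂ} (h0 : 0 < s.re) (h1 : s.re < 1) :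
    Complex.sin (Real.pi * s) ≠ 0 := by
  rw [Complex.sin_ne_zero_iff]
  intro k hk
  have hs : s = k := by
    have : (Real.pi : ℂ) ≠ 0 := by exact_mod_cast Real.pi_ne_zero
    apply mul_left_cancel₀ this
    rw [hk]; ring
  rw [hs, Complex.intCast_re] at h0 h1
  have a : (0 : ℤ) < k := by exact_mod_cast h0
  have b : k < (1 : ℤ) := by exact_mod_cast h1
  omega

theorem isOpen_strip : IsOpen {s : ℂ | 0 < s.re ∧ s.re < 1} :=
  (isOpen_lt continuous_const Complex.continuous_re).inter
    (isOpen_lt Complex.continuous_re continuous_const)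

theorem hasDerivAt_sin_pi_mul (s : ℂ) :
    HasDerivAt (fun s : ℂ => Complex.sin (Real.pi * s)) (Complex.cos (Real.pi * s) * Real.pi) s := by
  simpa using ((hasDerivAt_id s).const_mul (Real.pi : ℂ)).csin

theorem mellin_log_smul_one_add_inv {s : ℂ} (h0 : 0 < s.re) (h1 : s.re < 1) :
    mellin (fun t : ℝ => Real.log t • ((1 : ℂ) + t)⁻¹) s =
      -(Real.pi ^ 2 * Complex.cos (Real.pi * s)) / Complex.sin (Real.pi * s) ^ 2 := by
  -- The strip is open, so the closed form holds near `s` and may be differentiated.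
  have hev : (mellin fun t : ℝ => ((1 : ℂ) + t)⁻¹) =ᶠ[𝓝 s]
      fun s => Real.pi / Complex.sin (Real.pi * s) := by
    filter_upwards [isOpen_strip.mem_nhds ⟨h0, h1⟩] with z hz
    exact mellin_one_add_inv hz.1 hz.2
  have h2 := (hasDerivAt_const s (Real.pi : ℂ)).div (hasDerivAt_sin_pi_mul s)
    (sin_pi_mul_ne_zero_of_mem_strip h0 h1)
  rw [(hasDerivAt_mellin_one_add_inv h0 h1).unique (h2.congr_of_eventuallyEq hev)]
  ring

theorem mellin_log_sq_smul_one_add_inv {s : ℂ} (h0 : 0 < s.re) (h1 : s.re < 1) :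
    mellin (fun t : ℝ => Real.log t • Real.log t • ((1 : ℂ) + t)⁻¹) s =
      Real.pi ^ 3 * (2 - Complex.sin (Real.pi * s) ^ 2) / Complex.sin (Real.pi * s) ^ 3 := by
  have hev : (mellin fun t : ℝ => Real.log t • ((1 : ℂ) + t)⁻¹) =ᶠ[𝓝 s]
      fun s => -(Real.pi ^ 2 * Complex.cos (Real.pi * s)) / Complex.sin (Real.pi * s) ^ 2 := by
    filter_upwards [isOpen_strip.mem_nhds ⟨h0, h1⟩] with z hz
    exact mellin_log_smul_one_add_inv hz.1 hz.2
  have hsin := sin_pi_mul_ne_zero_of_mem_strip h0 h1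
  have hcos : HasDerivAt (fun s : ℂ => Complex.cos (Real.pi * s))
      (-Complex.sin (Real.pi * s) * Real.pi) s := by
    simpa using ((hasDerivAt_id s).const_mul (Real.pi : ℂ)).ccos
  have h2 := ((hcos.const_mul ((Real.pi : ℂ) ^ 2)).neg).div ((hasDerivAt_sin_pi_mul s).pow 2)
    (pow_ne_zero 2 hsin)
  rw [(hasDerivAt_mellin_log_smul_one_add_inv h0 h1).2.unique (h2.congr_of_eventuallyEq hev)]
  have hc : Complex.cos (Real.pi * s) ^ 2 = 1 - Complex.sin (Real.pi * s) ^ 2 := by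
    rw [← Complex.sin_sq_add_cos_sq (Real.pi * s)]; ring
  simp only [Pi.pow_apply, Pi.neg_apply]
  field_simp
  linear_combination 2 * Complex.sin (Real.pi * s) * hc

/-! ### Assembly at `s = 1/a` -/

theorem hasMellin_dilog_sum_kernel {s : ℂ} (h0 : 0 < s.re) (h1 : s.re < 1) :
    HasMellin (fun t : ℝ => (-(Real.pi ^ 2 / 6 : ℂ)) • ((1 : ℂ) + t)⁻¹ -
        (1 / 2 : ℂ) • (Real.log t • Real.log t • ((1 : ℂ) + t)⁻¹)) s
      (Real.pi ^ 3 / 3 * ((Complex.sin (Real.pi * s) ^ 2 - 3) / Complex.sin (Real.pi * s) ^ 3)) := by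
  have hA := mellinConvergent_one_add_inv h0 h1
  have hB := (hasDerivAt_mellin_log_smul_one_add_inv h0 h1).1
  have hA' := hasMellin_const_smul hA (-(Real.pi ^ 2 / 6 : ℂ))
  have hB' := hasMellin_const_smul hB (1 / 2 : ℂ)
  have h := hasMellin_sub hA'.1 hB'.1
  refine ⟨h.1, ?_⟩
  rw [h.2, hA'.2, hB'.2, mellin_one_add_inv h0 h1, mellin_log_sq_smul_one_add_inv h0 h1]
  have hsin := sin_pi_mul_ne_zero_of_mem_strip h0 h1
  simp only [smul_eq_mul]
  field_simp
  ring

theorem mainTheorem3 (a : ℝ) (ha : 1 < a) :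
    MeasureTheory.IntegrableOn
      (fun x : ℝ =>
        (dilog ((-(x ^ a) : ℝ) : ℂ) + dilog ((-(x ^ (-a)) : ℝ) : ℂ)) / ((1 + x ^ a : ℝ) : ℂ))
      (Set.Ioi (0 : ℝ)) ∧
    ∫ x in Set.Ioi (0 : ℝ),
        (dilog ((-(x ^ a) : ℝ) : ℂ) + dilog ((-(x ^ (-a)) : ℝ) : ℂ)) / ((1 + x ^ a : ℝ) : ℂ) =
      ((Real.pi ^ 3 / (3 * a) *
        ((Real.sin (Real.pi / a) ^ 2 - 3) / Real.sin (Real.pi / a) ^ 3) : ℝ) : ℂ) := by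
 
  set g : ℝ → ℂ := fun t : ℝ => (-(Real.pi ^ 2 / 6 : ℂ)) • ((1 : ℂ) + t)⁻¹ -
    (1 / 2 : ℂ) • (Real.log t • Real.log t • ((1 : ℂ) + t)⁻¹) with hg
  have ha0 : 0 < a := one_pos.trans ha
  have hre : ((1 : ℂ) / a).re = 1 / a := by
    rw [← Complex.ofReal_one, ← Complex.ofReal_div, Complex.ofReal_re]
  have h := hasMellin_dilog_sum_kernel (s := 1 / a) (by rw [hre]; positivity)
    (by rw [hre]; exact (div_lt_one ha0).2 ha)
  -- The trivial factor `t ^ (1 - 1)` exhibits a Mellin integrand at `1`, which `t ↦ t ^ a` moves to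
  -- `1/a`.
  have heq : EqOn (fun x : ℝ => (dilog ((-(x ^ a) : ℝ) : ℂ) + dilog ((-(x ^ (-a)) : ℝ) : ℂ)) /
      ((1 + x ^ a : ℝ) : ℂ)) (fun t : ℝ => (t : ℂ) ^ ((1 : ℂ) - 1) • g (t ^ a)) (Ioi 0) := by
    intro x (hx : 0 < x)
    have hxa : 0 < x ^ a := Real.rpow_pos_of_pos hx a
    simp only [Real.rpow_neg hx.le, dilog_neg_add_dilog_neg_inv hxa, hg, sub_self,
      Complex.cpow_zero, smul_eq_mul, Complex.real_smul]
    push_cast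
    ring
  constructor
  · rw [integrableOn_congr_fun heq measurableSet_Ioi]
    exact (MellinConvergent.comp_rpow ha0.ne').2 h.1
  · rw [setIntegral_congr_fun measurableSet_Ioi heq]
    change mellin (fun t : ℝ => g (t ^ a)) 1 = _
    rw [mellin_comp_rpow, h.2, abs_of_pos ha0, Complex.real_smul, mul_one_div]
    push_cast
    ring
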